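/- For $1\le p<\infty$ let $\mathcal F_p$ be the Fock space of all entire functions $f$ with $\|f\|_p^p=\frac{p}{2\pi}\int_{\mathbb C}|f(z)|^p e^{-p|z|^2/2}\,dA(z)<\infty$, where $dA$ is Lebesgue area measure on $\mathbb C$. A bounded operator $T$ satisfies Ritt's resolvent condition if there is a constant $M>0$ such that every $\lambda\in\mathbb C$ with $|\lambda|>1$ lies in the resolvent set of $T$ and $\|(\lambda I-T)^{-1}\|\le \frac{M}{|\lambda-1|}$. Theorem. Let $1\le p<\infty$ and let $u,\psi$ be entire functions such that the weighted composition operator $W_{(u,\psi)}f=u\cdot(f\circ\psi)$ is a bounded operator on $\mathcal F_p$. If $u\not\equiv 0$, then $\psi(z)=az+b$ for some $a,b\in\mathbb C$ with $|a|\le 1$. Moreover, whenever $\psi(z)=az+b$ with $|a|\le1$ (also if $u\equiv0$), the following hold. (i) If $|a|=1$, then $W_{(u,\psi)}$ satisfies Ritt's resolvent condition if and only if one of the following holds: - $a=1$, $b=0$ and $|u(0)|<1$; - $a=1$, $b=0$ and $u(0)=1$; - $a=1$, $b\ne0$ and $|u(0)|<e^{-|b|^2/2}$; - $a\ne1$ and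 $|u(0)|<e^{-|b|^2/2}$. (ii) Suppose that $W_{(u,\psi)}$ is compact. If $u\not\equiv0$, then $|a|<1$. If $a\neq 1$ (which is thus automatic unless $u\equiv 0$), then: if $W_{(u,\psi)}$ satisfies Ritt's resolvent condition, then $\left|u\left(\frac{b}{1-a}\right)\right|\le1$; conversely, if $\left|u\left(\frac{b}{1-a}\right)\right|<1$, then $W_{(u,\psi)}$ satisfies Ritt's resolvent condition. -/

import Mathlib

open MeasureTheory

/-- The Fock space `F_p`, as a set of functions: all entire functions `f` with
`∫ |f(z)|^p e^{-p|z|²/2} dA(z) < ∞`, where `dA` is Lebesgue area measure on `ℂ`. -/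
def MemFock (p : ℝ) (f : ℂ → ℂ) : Prop :=
  Differentiable ℂ f ∧
    Integrable (fun z : ℂ => ‖f z‖ ^ p * Real.exp (-(p * ‖z‖ ^ 2 / 2))) volume

/-- `‖f‖_p = ((p / 2π) ∫ |f(z)|^p e^{-p|z|²/2} dA(z))^{1/p}`. -/
noncomputable def fockNorm (p : ℝ) (f : ℂ → ℂ) : ℝ :=
  (p / (2 * Real.pi) * ∫ z : ℂ, ‖f z‖ ^ p * Real.exp (-(p * ‖z‖ ^ 2 / 2))) ^ (1 / p)

/-- The function `f(z) e^{-|z|²/2}`, through which the Fock norm is an ordinary `L^p` norm. -/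
noncomputable def fockWeighted (f : ℂ → ℂ) (z : ℂ) : ℂ :=
  f z * (Real.exp (-(‖z‖ ^ 2 / 2)) : ℂ)

theorem norm_fockWeighted_rpow (p : ℝ) (f : ℂ → ℂ) (z : ℂ) :
    ‖fockWeighted f z‖ ^ p = ‖f z‖ ^ p * Real.exp (-(p * ‖z‖ ^ 2 / 2)) := by
  have h : ‖((Real.exp (-(‖z‖ ^ 2 / 2)) : ℝ) : ℂ)‖ = Real.exp (-(‖z‖ ^ 2 / 2)) := by
    rw [Complex.norm_real, Real.norm_of_nonneg (Real.exp_pos _).le]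
  rw [fockWeighted, norm_mul, h, Real.mul_rpow (norm_nonneg _) (Real.exp_pos _).le,
    ← Real.exp_mul]
  congr 2
  ring

theorem continuous_fockWeighted {f : ℂ → ℂ} (hf : Differentiable ℂ f) :
    Continuous (fockWeighted f) := by
  have := hf.continuous
  unfold fockWeighted
  fun_prop

theorem memFock_iff_memLp {p : ℝ} (hp : 1 ≤ p) {f : ℂ → ℂ} :
    MemFock p f ↔
      Differentiable ℂ f ∧ MemLp (fockWeighted f) (ENNReal.ofReal p) volume := by
  have h0 : ENNReal.ofReal p ≠ 0 := by
    simp only [ne_eq, ENNReal.ofReal_eq_zero, not_le]; linarith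
  refine and_congr_right fun hf => ?_
  rw [← integrable_norm_rpow_iff (continuous_fockWeighted hf).aestronglyMeasurable h0
    ENNReal.ofReal_ne_top, ENNReal.toReal_ofReal (by linarith)]
  simp only [norm_fockWeighted_rpow]

theorem fockNorm_eq {p : ℝ} (hp : 1 ≤ p) {f : ℂ → ℂ} (hf : MemFock p f) :
    fockNorm p f = (p / (2 * Real.pi)) ^ (1 / p) *
      (eLpNorm (fockWeighted f) (ENNReal.ofReal p) volume).toReal := by
  have h0 : ENNReal.ofReal p ≠ 0 := by
    simp only [ne_eq, ENNReal.ofReal_eq_zero, not_le]; linarith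
  have hi : 0 ≤ ∫ z : ℂ, ‖f z‖ ^ p * Real.exp (-(p * ‖z‖ ^ 2 / 2)) :=
    integral_nonneg fun z => by positivity
  rw [((memFock_iff_memLp hp).1 hf).2.eLpNorm_eq_integral_rpow_norm h0 ENNReal.ofReal_ne_top,
    ENNReal.toReal_ofReal (by positivity), ENNReal.toReal_ofReal (by linarith)]
  simp only [norm_fockWeighted_rpow]
  rw [fockNorm, Real.mul_rpow (by positivity) hi, one_div]

theorem fockWeighted_add (f g : ℂ → ℂ) :
    fockWeighted (f + g) = fockWeighted f + fockWeighted g := by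
  funext z; simp [fockWeighted, add_mul]

theorem fockWeighted_smul (c : ℂ) (f : ℂ → ℂ) :
    fockWeighted (c • f) = c • fockWeighted f := by
  funext z; simp [fockWeighted, mul_assoc]

/-- The Fock space `F_p` as a linear subspace of the space of all functions. -/
def fockSubmodule (p : ℝ) [hp : Fact (1 ≤ p)] : Submodule ℂ (ℂ → ℂ) where
  carrier := {f | MemFock p f}
  add_mem' := by
    intro f g hf hg
    simp only [Set.mem_ofPred_eq, memFock_iff_memLp hp.out] at hf hg ⊢
    exact ⟨hf.1.add hg.1, by rw [fockWeighted_add]; exact hf.2.add hg.2⟩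
  zero_mem' := by
    simp only [Set.mem_ofPred_eq, memFock_iff_memLp hp.out]
    refine ⟨differentiable_const 0, ?_⟩
    have : fockWeighted 0 = 0 := by funext z; simp [fockWeighted]
    rw [this]
    exact MemLp.zero
  smul_mem' := by
    intro c f hf
    simp only [Set.mem_ofPred_eq, memFock_iff_memLp hp.out] at hf ⊢
    exact ⟨hf.1.const_smul c, by rw [fockWeighted_smul]; exact hf.2.const_smul c⟩

/-- The Fock space `F_p` as a type. It is a `def`, so that it does not inherit the topology of
pointwise convergence; its topology is the one of the norm below. -/
def Fock (p : ℝ) [Fact (1 ≤ p)] : Type := fockSubmodule p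

instance Fock.instAddCommGroup (p : ℝ) [Fact (1 ≤ p)] : AddCommGroup (Fock p) :=
  inferInstanceAs (AddCommGroup (fockSubmodule p))

instance Fock.instModule (p : ℝ) [Fact (1 ≤ p)] : Module ℂ (Fock p) :=
  inferInstanceAs (Module ℂ (fockSubmodule p))

instance Fock.instFunLike (p : ℝ) [Fact (1 ≤ p)] : FunLike (Fock p) ℂ ℂ where
  coe f := f.1
  coe_injective := Subtype.val_injective

noncomputable instance Fock.instNorm (p : ℝ) [Fact (1 ≤ p)] : Norm (Fock p) where
  norm f := fockNorm p f

theorem Fock.memFock {p : ℝ} [Fact (1 ≤ p)] (f : Fock p) : MemFock p f := f.2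

theorem Fock.norm_def {p : ℝ} [Fact (1 ≤ p)] (f : Fock p) : ‖f‖ = fockNorm p f := rfl

theorem Fock.coe_add {p : ℝ} [Fact (1 ≤ p)] (f g : Fock p) : ⇑(f + g) = ⇑f + ⇑g := rfl

theorem Fock.coe_smul {p : ℝ} [Fact (1 ≤ p)] (c : ℂ) (f : Fock p) : ⇑(c • f) = c • ⇑f := rfl

theorem Fock.coe_zero {p : ℝ} [Fact (1 ≤ p)] : ⇑(0 : Fock p) = 0 := rfl

theorem Fock.normedSpaceCore (p : ℝ) [hp : Fact (1 ≤ p)] : NormedSpace.Core ℂ (Fock p) where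
  norm_nonneg f := by
    rw [Fock.norm_def, fockNorm_eq hp.out f.memFock]
    have := hp.out
    positivity
  norm_smul c f := by
    rw [Fock.norm_def, Fock.norm_def, fockNorm_eq hp.out f.memFock,
      fockNorm_eq hp.out (c • f).memFock, Fock.coe_smul, fockWeighted_smul, eLpNorm_const_smul,
      ENNReal.toReal_mul, toReal_enorm]
    ring
  norm_triangle f g := by
    have hf := ((memFock_iff_memLp hp.out).1 f.memFock).2
    have hg := ((memFock_iff_memLp hp.out).1 g.memFock).2
    have hp0 := hp.out
    rw [Fock.norm_def, Fock.norm_def, Fock.norm_def, fockNorm_eq hp.out f.memFock,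
      fockNorm_eq hp.out g.memFock, fockNorm_eq hp.out (f + g).memFock, Fock.coe_add,
      fockWeighted_add, ← mul_add, ← ENNReal.toReal_add hf.2.ne hg.2.ne]
    refine mul_le_mul_of_nonneg_left ?_ (by positivity)
    refine ENNReal.toReal_mono (ENNReal.add_ne_top.2 ⟨hf.2.ne, hg.2.ne⟩) ?_
    exact eLpNorm_add_le hf.1 hg.1 (by simpa using ENNReal.ofReal_le_ofReal hp.out)
  norm_eq_zero_iff f := by
    have hp0 := hp.out
    have hf := (memFock_iff_memLp hp.out).1 f.memFock
    have h0 : ENNReal.ofReal p ≠ 0 := by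
      simp only [ne_eq, ENNReal.ofReal_eq_zero, not_le]; linarith
    have hc : (p / (2 * Real.pi)) ^ (1 / p) ≠ 0 := by positivity
    rw [Fock.norm_def, fockNorm_eq hp.out f.memFock, mul_eq_zero, or_iff_right hc,
      ENNReal.toReal_eq_zero_iff, or_iff_left hf.2.2.ne, eLpNorm_eq_zero_iff hf.2.1 h0]
    constructor
    · intro h
      have h' : fockWeighted f = 0 :=
        ((continuous_fockWeighted hf.1).ae_eq_iff_eq volume continuous_const).1 h
      refine DFunLike.coe_injective (funext fun z => ?_)
      have hz := congrFun h' z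
      simp only [fockWeighted, Pi.zero_apply, mul_eq_zero, Complex.ofReal_eq_zero,
        (Real.exp_pos _).ne', or_false] at hz
      rw [hz, Fock.coe_zero, Pi.zero_apply]
    · rintro rfl
      have : fockWeighted (⇑(0 : Fock p)) = 0 := by
        funext z; simp [fockWeighted, Fock.coe_zero]
      rw [this]

/-- `F_p` with its norm `‖·‖_p` is a normed group. -/
noncomputable instance Fock.instNormedAddCommGroup (p : ℝ) [Fact (1 ≤ p)] :
    NormedAddCommGroup (Fock p) :=
  NormedAddCommGroup.ofCore (Fock.normedSpaceCore p)

/-- `F_p` with its norm `‖·‖_p` is a complex normed space. -/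
noncomputable instance Fock.instNormedSpace (p : ℝ) [Fact (1 ≤ p)] : NormedSpace ℂ (Fock p) :=
  NormedSpace.ofCore (Fock.normedSpaceCore p)

/-- The bounded operator `W` on `F_p` is the weighted composition operator
`W_{(u,ψ)} : f ↦ u · (f ∘ ψ)`. Such a `W` exists if and only if `f ↦ u · (f ∘ ψ)` maps `F_p`
into itself and is bounded, and it is then unique. -/
def IsWeightedComposition {p : ℝ} [Fact (1 ≤ p)] (u ψ : ℂ → ℂ) (W : Fock p →L[ℂ] Fock p) : Prop :=
  ∀ (f : Fock p) (z : ℂ), W f z = u z * f (ψ z)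

/-- Ritt's resolvent condition for a bounded operator `T`: there is `M > 0` such that every
`lam` with `|lam| > 1` lies in the resolvent set of `T` and
`‖(lam I - T)⁻¹‖ ≤ M / |lam - 1|`. -/
def RittCondition {X : Type*} [NormedAddCommGroup X] [NormedSpace ℂ X] (T : X →L[ℂ] X) : Prop :=
  ∃ M : ℝ, 0 < M ∧ ∀ lam : ℂ, 1 < ‖lam‖ →
    lam ∈ resolventSet ℂ T ∧ ‖resolvent T lam‖ ≤ M / ‖lam - 1‖

/-! Testing `W` on normalised reproducing kernels bounds `|u| exp((|ψ|² - |z|²)/2)`. Jensen's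
formula for `u` then makes the circle means of `|ψ|` grow at most like the radius, and Cauchy's
estimates leave `ψ` affine with `|a| ≤ 1`.

If `|a| = 1`, Liouville's theorem gives `W = cV` with `V` a Weyl isometry and `|c| = |u(0)|
exp(|b|²/2)`. If `|c| < 1`, the spectrum lies in the open unit disc, which implies Ritt's condition.
If `|c| ≥ 1`, Ritt's condition leaves only `1` as a spectral value. A nonzero translation excludes
this, because a second Weyl operator conjugates `W` to `-W`; so does `a ≠ 1`, because `u(z₀)` and `a
u(z₀)` are both spectral values at the fixed point `z₀`. For `ψ = id`, `W` is the scalar `u(0)`.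

If `W` is compact, its nonzero spectrum consists of eigenvalues, and orders of vanishing at `z₀`
show that these have the form `u(z₀) aⁿ`. -/

/-! ### Ritt's condition and the location of the spectrum. -/

/-- An operator whose spectrum lies in the open unit disc satisfies Ritt's condition. -/
theorem rittCondition_of_forall_mem_resolventSet {X : Type*} [NormedAddCommGroup X]
    [NormedSpace ℂ X] [CompleteSpace X] {T : X →L[ℂ] X}
    (h : ∀ lam : ℂ, 1 ≤ ‖lam‖ → lam ∈ resolventSet ℂ T) : RittCondition T := by
  have hK : IsCompact (Metric.closedBall (0 : ℂ) (‖T‖ + 1) ∩ {z | 1 ≤ ‖z‖}) :=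
    (isCompact_closedBall _ _).inter_right (isClosed_le continuous_const continuous_norm)
  have hc : ContinuousOn (fun z : ℂ => ‖z - 1‖ * ‖resolvent T z‖)
      (Metric.closedBall (0 : ℂ) (‖T‖ + 1) ∩ {z | 1 ≤ ‖z‖}) := by
    refine ContinuousOn.mul (by fun_prop) (ContinuousOn.norm fun z hz => ?_)
    exact (spectrum.hasDerivAt_resolvent_const_left (h z hz.2)).continuousAt.continuousWithinAt
  obtain ⟨C, hC⟩ := hK.exists_bound_of_continuousOn hc
  -- `C` serves the compact annulus. Outside it the resolvent has norm at most `1`, and `lam R = 1 +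
  -- T R` gives `‖lam - 1‖ ‖R‖ ≤ 1 + (‖T‖ + 1) ‖R‖ ≤ ‖T‖ + 2`.
  refine ⟨max C (‖T‖ + 2), lt_max_of_lt_right (by positivity), fun lam hlam =>
    ⟨h lam hlam.le, ?_⟩⟩
  have hpos : 0 < ‖lam - 1‖ := by
    rw [norm_pos_iff, sub_ne_zero]
    rintro rfl
    simp at hlam
  rw [le_div_iff₀ hpos, mul_comm]
  by_cases hb : ‖lam‖ ≤ ‖T‖ + 1
  · refine le_trans ?_ ((hC lam ⟨by simpa using hb, hlam.le⟩).trans (le_max_left _ _))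
    exact le_abs_self _
  · push Not at hb
    refine le_trans ?_ (le_max_right _ _)
    have h1 : lam • resolvent T lam = 1 + T * resolvent T lam := by
      have h2 := Ring.mul_inverse_cancel _ (spectrum.mem_resolventSet_iff.1 (h lam hlam.le))
      rw [sub_mul] at h2
      rw [resolvent, ← h2, Algebra.algebraMap_eq_smul_one]
      simp
    have h3 : ‖lam‖ * ‖resolvent T lam‖ ≤ 1 + ‖T‖ * ‖resolvent T lam‖ := by
      rw [← norm_smul, h1]
      refine (norm_add_le _ _).trans (add_le_add ?_ (norm_mul_le _ _))
      exact ContinuousLinearMap.norm_id_le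
    have h4 : ‖resolvent T lam‖ ≤ 1 := by
      nlinarith [norm_nonneg (resolvent T lam), norm_nonneg T]
    have h5 : ‖lam - 1‖ ≤ ‖lam‖ + 1 := by simpa using norm_sub_le lam 1
    nlinarith [norm_nonneg (resolvent T lam), norm_nonneg T]

/-- The spectrum of an operator with Ritt's condition meets the complement of the open unit disc
at most in the point `1`. -/
theorem RittCondition.norm_lt_one_or_eq_one {X : Type*} [NormedAddCommGroup X]
    [NormedSpace ℂ X] [CompleteSpace X] {T : X →L[ℂ] X} (hT : RittCondition T) {μ : ℂ}
    (hμ : μ ∈ spectrum ℂ T) : ‖μ‖ < 1 ∨ μ = 1 := by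
  obtain ⟨M, hM, h⟩ := hT
  by_contra! hcon
  obtain ⟨h1, hne⟩ := hcon
  rcases h1.lt_or_eq with h1 | h1
  · exact hμ (h μ h1).1
  apply hμ
  have hd : 0 < ‖μ - 1‖ := by rwa [norm_pos_iff, sub_ne_zero]
  set d := ‖μ - 1‖
  -- The point `lam = (1 + t) μ` lies outside the disc at distance `t` from `μ` and at least `d/2`
  -- from `1`. Hence `t ‖R(lam)‖ ≤ M / (2(M + 1)) < 1`, and a Neumann series at `lam` reaches `μ`.
  set t : ℝ := d / (4 * (M + 1)) with ht
  have ht0 : 0 < t := by positivity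
  have htd : t ≤ d / 2 := by
    rw [ht, div_le_div_iff₀ (by positivity) (by positivity)]
    nlinarith
  set lam : ℂ := (1 + t : ℝ) * μ with hlam
  have hlam1 : 1 < ‖lam‖ := by
    rw [hlam, norm_mul, ← h1, Complex.norm_real, Real.norm_of_nonneg (by positivity)]
    linarith
  have hdiff : ‖lam - μ‖ = t := by
    have : lam - μ = (t : ℝ) * μ := by rw [hlam]; push_cast; ring
    rw [this, norm_mul, ← h1, Complex.norm_real, Real.norm_of_nonneg ht0.le, mul_one]
  have hlow : d / 2 ≤ ‖lam - 1‖ := by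
    have h2 : d ≤ ‖lam - 1‖ + ‖lam - μ‖ := by
      have h3 : μ - 1 = (lam - 1) - (lam - μ) := by ring
      calc d = ‖(lam - 1) - (lam - μ)‖ := by rw [← h3]
        _ ≤ _ := norm_sub_le _ _
    linarith
  obtain ⟨hres, hbd⟩ := h lam hlam1
  have hR : ‖resolvent T lam‖ ≤ M / (d / 2) :=
    hbd.trans (by gcongr)
  have hlt : ‖(lam - μ) • resolvent T lam‖ < 1 := by
    rw [norm_smul, hdiff]
    calc t * ‖resolvent T lam‖ ≤ t * (M / (d / 2)) := by gcongr
      _ = M / (2 * (M + 1)) := by rw [ht]; field_simp; norm_num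
      _ < 1 := by rw [div_lt_one (by positivity)]; linarith
  have hu := (isUnit_one_sub_of_norm_lt_one hlt)
  have hfac : algebraMap ℂ (X →L[ℂ] X) μ - T
      = (algebraMap ℂ (X →L[ℂ] X) lam - T) * (1 - (lam - μ) • resolvent T lam) := by
    have h2 := Ring.mul_inverse_cancel _ (spectrum.mem_resolventSet_iff.1 hres)
    rw [mul_sub, mul_one, mul_smul_comm, resolvent, h2, sub_smul,
      Algebra.algebraMap_eq_smul_one, Algebra.algebraMap_eq_smul_one]
    abel
  rw [spectrum.mem_resolventSet_iff, hfac]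
  exact (spectrum.mem_resolventSet_iff.1 hres).mul hu

/-! ### Weyl operators. -/

/-- The cross term is the real part of a linear function of `z`, so a holomorphic exponential can
compensate for the change of Gaussian weight. -/
theorem norm_mul_add_sq {a : ℂ} (ha : ‖a‖ = 1) (b z : ℂ) :
    ‖a * z + b‖ ^ 2 = ‖z‖ ^ 2 + ‖b‖ ^ 2 + 2 * (a * starRingEnd ℂ b * z).re := by
  rw [Complex.sq_norm, Complex.normSq_add, ← Complex.sq_norm, ← Complex.sq_norm, norm_mul, ha,
    one_mul]
  congr 3
  ring

/-- The function `z ↦ exp(-a b̄ z - |b|²/2) f(az + b)`. -/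
noncomputable def weylFun (a b : ℂ) (f : ℂ → ℂ) (z : ℂ) : ℂ :=
  Complex.exp (-(a * starRingEnd ℂ b * z) - (‖b‖ ^ 2 / 2 : ℝ)) * f (a * z + b)

theorem norm_fockWeighted_weylFun {a : ℂ} (ha : ‖a‖ = 1) (b : ℂ) (f : ℂ → ℂ) (z : ℂ) :
    ‖fockWeighted (weylFun a b f) z‖ = ‖fockWeighted f (a * z + b)‖ := by
  simp only [fockWeighted, weylFun, norm_mul, Complex.norm_real, Real.norm_of_nonneg
    (Real.exp_pos _).le, Complex.norm_exp]
  rw [mul_right_comm, ← Real.exp_add, mul_comm]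
  congr 2
  rw [norm_mul_add_sq ha]
  simp only [Complex.sub_re, Complex.neg_re, Complex.ofReal_re]
  ring

theorem measurePreserving_mul_add {a : ℂ} (ha : ‖a‖ = 1) (b : ℂ) :
    MeasurePreserving (fun z : ℂ => a * z + b) := by
  have h1 := (rotation (⟨a, by simpa [Submonoid.unitSphere] using ha⟩ : Circle)).measurePreserving
  have h2 := measurePreserving_add_right (volume : Measure ℂ) b
  exact h2.comp h1

theorem measurableEmbedding_mul_add {a : ℂ} (ha : ‖a‖ = 1) (b : ℂ) :
    MeasurableEmbedding (fun z : ℂ => a * z + b) := by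
  have h1 := (rotation (⟨a, by simpa [Submonoid.unitSphere] using ha⟩ :
    Circle)).toHomeomorph.measurableEmbedding
  have h2 := measurableEmbedding_addRight b
  exact h2.comp h1

theorem memFock_weylFun {p : ℝ} {a : ℂ} (ha : ‖a‖ = 1) (b : ℂ) {f : ℂ → ℂ} (hf : MemFock p f) :
    MemFock p (weylFun a b f) := by
  refine ⟨?_, ?_⟩
  · have := hf.1
    unfold weylFun
    fun_prop
  · have h := ((measurePreserving_mul_add ha b).integrable_comp_emb
      (measurableEmbedding_mul_add ha b)).2 hf.2
    refine h.congr (Filter.Eventually.of_forall fun z => ?_)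
    simp only [Function.comp, ← norm_fockWeighted_rpow, norm_fockWeighted_weylFun ha]

theorem fockNorm_weylFun {p : ℝ} {a : ℂ} (ha : ‖a‖ = 1) (b : ℂ) (f : ℂ → ℂ) :
    fockNorm p (weylFun a b f) = fockNorm p f := by
  have h := (measurePreserving_mul_add ha b).integral_comp (measurableEmbedding_mul_add ha b)
    (fun z => ‖f z‖ ^ p * Real.exp (-(p * ‖z‖ ^ 2 / 2)))
  rw [fockNorm, fockNorm, ← h]
  simp only [← norm_fockWeighted_rpow, norm_fockWeighted_weylFun ha]

theorem weylFun_weylFun {a a' : ℂ} (ha : a * a' = 1) (hconj : starRingEnd ℂ a = a') (b : ℂ)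
    (f : ℂ → ℂ) : weylFun a b (weylFun a' (-(a' * b)) f) = f := by
  funext z
  have hn : ‖a'‖ = 1 := by
    have h1 : ‖a‖ * ‖a'‖ = 1 := by rw [← norm_mul, ha, norm_one]
    have h2 : ‖a'‖ = ‖a‖ := by rw [← hconj, Complex.norm_conj]
    rw [h2] at h1 ⊢
    nlinarith [norm_nonneg a]
  have hc' : starRingEnd ℂ a' = a := by rw [← hconj, Complex.conj_conj]
  have hbb : starRingEnd ℂ b * b = ((‖b‖ ^ 2 : ℝ) : ℂ) := by
    rw [Complex.conj_mul']; push_cast; rfl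
  simp only [weylFun]
  rw [norm_neg, norm_mul, hn, one_mul, ← mul_assoc, ← Complex.exp_add]
  have e1 : a' * (a * z + b) + -(a' * b) = z := by linear_combination z * ha
  have e2 : -(a * starRingEnd ℂ b * z) - ((‖b‖ ^ 2 / 2 : ℝ) : ℂ) +
      (-(a' * starRingEnd ℂ (-(a' * b)) * (a * z + b)) - ((‖b‖ ^ 2 / 2 : ℝ) : ℂ)) = 0 := by
    rw [map_neg, map_mul, hc']
    push_cast at hbb ⊢
    linear_combination (starRingEnd ℂ b * (a * z + b)) * ha + hbb
  rw [e1, e2, Complex.exp_zero, one_mul]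

namespace Fock

variable {p : ℝ} [Fact (1 ≤ p)]

theorem differentiable (f : Fock p) : Differentiable ℂ f := f.memFock.1

/-- A function satisfying `MemFock`, as an element of `F_p`. -/
def mk (f : ℂ → ℂ) (hf : MemFock p f) : Fock p := ⟨f, hf⟩

theorem coe_mk {f : ℂ → ℂ} (hf : MemFock p f) : ⇑(mk f hf) = f := rfl

theorem coe_sub (f g : Fock p) : ⇑(f - g) = ⇑f - ⇑g := rfl

/-- The Weyl operator `f ↦ exp(-a b̄ z - |b|²/2) f(az + b)`, `|a| = 1`, as a surjective linear
isometry of `F_p`. -/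
noncomputable def weyl (a : ℂ) (ha : ‖a‖ = 1) (b : ℂ) : Fock p ≃ₗᵢ[ℂ] Fock p where
  toFun f := mk (weylFun a b f) (memFock_weylFun ha b f.memFock)
  invFun f := mk (weylFun (starRingEnd ℂ a) (-(starRingEnd ℂ a * b)) f)
    (memFock_weylFun (by rwa [Complex.norm_conj]) _ f.memFock)
  map_add' f g := DFunLike.coe_injective (funext fun z => by
    simp [coe_mk, coe_add, weylFun, mul_add])
  map_smul' c f := DFunLike.coe_injective (funext fun z => by
    simp [coe_mk, coe_smul, weylFun]; ring)
  left_inv f := DFunLike.coe_injective (by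
    have h := weylFun_weylFun (a := starRingEnd ℂ a) (a' := a)
      (by rw [Complex.conj_mul', ha]; simp) (by simp) (-(starRingEnd ℂ a * b)) f
    have h2 : -(a * -(starRingEnd ℂ a * b)) = b := by
      rw [mul_neg, neg_neg, ← mul_assoc, Complex.mul_conj', ha]; simp
    rw [h2] at h
    exact h)
  right_inv f := DFunLike.coe_injective
    (weylFun_weylFun (by rw [Complex.mul_conj', ha]; simp) rfl b f)
  norm_map' f := fockNorm_weylFun ha b f

theorem weyl_apply (a : ℂ) (ha : ‖a‖ = 1) (b : ℂ) (f : Fock p) (z : ℂ) :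
    weyl a ha b f z
      = Complex.exp (-(a * starRingEnd ℂ b * z) - (‖b‖ ^ 2 / 2 : ℝ)) * f (a * z + b) := rfl

end Fock

/-! ### Mean values, Jensen's formula and affine symbols. -/

/-- The disc integral is invariant under rotations. Averaging over all of them and exchanging the
integrals replaces `f z` by its circle mean `f 0`. -/
theorem integral_ball_of_differentiable {f : ℂ → ℂ} (hf : Differentiable ℂ f) :
    ∫ z in Metric.ball (0 : ℂ) 1, f z = Real.pi * f 0 := by
  have hrot (θ : ℝ) : ∫ z in Metric.ball (0 : ℂ) 1, f (circleMap 0 1 θ * z)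
      = ∫ z in Metric.ball (0 : ℂ) 1, f z := by
    have hn : ‖circleMap 0 1 θ‖ = 1 := by simp
    have h := (measurePreserving_mul_add hn 0).setIntegral_preimage_emb
      (measurableEmbedding_mul_add hn 0) f (Metric.ball 0 1)
    have h2 : (fun z : ℂ => circleMap 0 1 θ * z + 0) ⁻¹' Metric.ball 0 1 = Metric.ball 0 1 := by
      ext z; simp
    rw [h2] at h
    simpa using h
  have hmean (z : ℂ) : ∫ θ in (0 : ℝ)..2 * Real.pi, f (circleMap 0 1 θ * z)
      = (2 * Real.pi : ℝ) * f 0 := by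
    have hg : Differentiable ℂ fun w => f (w * z) := by fun_prop
    have h := (hg.diffContOnCl (s := Metric.ball 0 |1|)).circleAverage
    rw [Real.circleAverage_def, zero_mul] at h
    have hpi : (2 * Real.pi) ≠ 0 := by positivity
    rw [inv_smul_eq_iff₀ hpi] at h
    simpa using h
  have hcont : Continuous (fun q : ℝ × ℂ => f (circleMap 0 1 q.1 * q.2)) := by
    have := hf.continuous
    fun_prop
  obtain ⟨C, hC⟩ := (isCompact_closedBall (0 : ℂ) 1).exists_bound_of_continuousOn
    hf.continuous.continuousOn
  have hswap := intervalIntegral_integral_swap (μ := volume.restrict (Metric.ball (0 : ℂ) 1))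
    (a := 0) (b := 2 * Real.pi) (f := fun θ z => f (circleMap 0 1 θ * z)) (by
      have : IsFiniteMeasure ((volume.restrict (Set.uIoc 0 (2 * Real.pi))).prod
        (volume.restrict (Metric.ball (0 : ℂ) 1))) := by
        have h1 : IsFiniteMeasure (volume.restrict (Metric.ball (0 : ℂ) 1)) :=
          ⟨by simp⟩
        have h2 : IsFiniteMeasure (volume.restrict (Set.uIoc 0 (2 * Real.pi))) :=
          ⟨by simp [ENNReal.mul_lt_top]⟩
        infer_instance
      rw [Measure.prod_restrict] at this ⊢
      refine Integrable.of_bound hcont.aestronglyMeasurable C ?_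
      refine (ae_restrict_iff' (measurableSet_uIoc.prod measurableSet_ball)).2
        (Filter.Eventually.of_forall fun q hq => hC _ ?_)
      have := hq.2
      simp only [Metric.mem_ball, dist_zero_right] at this
      simpa using this.le)
  simp only [hrot, hmean] at hswap
  rw [intervalIntegral.integral_const, setIntegral_const] at hswap
  have hv : (volume : Measure ℂ).real (Metric.ball 0 1) = Real.pi := by
    simp [Measure.real]
  rw [hv] at hswap
  have hpi : ((2 * Real.pi : ℝ) : ℂ) ≠ 0 := by
    norm_cast; positivity
  apply mul_left_cancel₀ hpi
  simp only [sub_zero, Complex.real_smul] at hswap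
  rw [hswap]
  ring

/-- In Jensen's formula every zero in the disc contributes a nonnegative term. -/
theorem log_norm_le_circleAverage {u : ℂ → ℂ} (hu : Differentiable ℂ u) {c : ℂ} (hc : u c ≠ 0)
    {R : ℝ} (hR : 0 < R) :
    Real.log ‖u c‖ ≤ Real.circleAverage (fun z => Real.log ‖u z‖) c R := by
  have han : AnalyticOnNhd ℂ u (Metric.closedBall c |R|) := fun z _ => hu.analyticAt z
  rw [AnalyticOnNhd.circleAverage_log_norm hR.ne' han hc, le_add_iff_nonneg_left]
  refine finsum_nonneg fun z => ?_
  by_cases hz : z ∈ Metric.closedBall c |R|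
  · refine mul_nonneg ?_ ?_
    · exact_mod_cast (MeromorphicOn.AnalyticOnNhd.divisor_nonneg han) z
    · rcases eq_or_ne z c with rfl | hne
      · simp
      · have hpos : 0 < ‖c - z‖ := norm_pos_iff.2 (sub_ne_zero.2 hne.symm)
        refine Real.log_nonneg ?_
        rw [← div_eq_mul_inv, one_le_div hpos]
        rw [abs_of_pos hR, Metric.mem_closedBall, dist_comm, dist_eq_norm] at hz
        exact hz
  · rw [Function.locallyFinsuppWithin.apply_eq_zero_of_notMem _ hz]
    simp

theorem circleIntegrable_of_continuous {f : ℂ → ℝ} (hf : Continuous f) {c : ℂ} {R : ℝ} :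
    CircleIntegrable f c R :=
  hf.continuousOn.circleIntegrable'

/-- If `|u| exp((|ψ|² - |z|²)/2)` is bounded, `u ≢ 0`, then the mean of `|ψ|` over circles grows
at most like the radius. -/
theorem circleAverage_norm_le {u ψ : ℂ → ℂ} (hu : Differentiable ℂ u) (hψ : Differentiable ℂ ψ)
    {K : ℝ} (hK : ∀ z, ‖u z‖ * Real.exp (‖ψ z‖ ^ 2 / 2) ≤ K * Real.exp (‖z‖ ^ 2 / 2))
    {c : ℂ} (hc : u c ≠ 0) :
    ∃ B : ℝ, 0 ≤ B ∧ ∀ R, 0 < R →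
      Real.circleAverage (fun z => ‖ψ z‖) c R ≤ Real.sqrt ((R + ‖c‖) ^ 2 + B) := by
  have hKpos : 0 < K := by
    have h1 : 0 < ‖u c‖ * Real.exp (‖ψ c‖ ^ 2 / 2) := by positivity
    have h2 := h1.trans_le (hK c)
    exact pos_of_mul_pos_left h2 (Real.exp_pos _).le
  set B := |2 * (Real.log K - Real.log ‖u c‖)| with hB
  refine ⟨B, abs_nonneg _, fun R hR => ?_⟩
  set s := Real.sqrt ((R + ‖c‖) ^ 2 + B) with hs
  have hs2 : s ^ 2 = (R + ‖c‖) ^ 2 + B := Real.sq_sqrt (by positivity)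
  have hspos : 0 < s := Real.sqrt_pos.2 (by positivity)
  have hcψ := hψ.continuous
  have i1 : CircleIntegrable (fun z => Real.log ‖u z‖) c R :=
    MeromorphicOn.circleIntegrable_log_norm fun z _ => (hu.analyticAt z).meromorphicAt
  have i2 : CircleIntegrable (fun z => ‖ψ z‖ ^ 2 / 2) c R :=
    circleIntegrable_of_continuous (by fun_prop)
  have hsq : Real.circleAverage (fun z => ‖ψ z‖ ^ 2 / 2) c R ≤ s ^ 2 / 2 := by
    have hle : Real.circleAverage (fun z => Real.log ‖u z‖ + ‖ψ z‖ ^ 2 / 2) c R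
        ≤ Real.log K + (R + ‖c‖) ^ 2 / 2 := by
      set C := Real.log K + (R + ‖c‖) ^ 2 / 2
      -- Since `Real.log 0 = 0`, the pointwise bound may fail at zeros of `u`. Redefining the
      -- integrand there does not change the mean, because the zeros are isolated.
      set g : ℂ → ℝ := fun z => if u z = 0 then C else Real.log ‖u z‖ + ‖ψ z‖ ^ 2 / 2
      have hdis : (fun z => Real.log ‖u z‖ + ‖ψ z‖ ^ 2 / 2)
          =ᶠ[Filter.codiscreteWithin (Metric.sphere c |R|)] g := by
        have han : AnalyticOnNhd ℂ u Set.univ := fun z _ => hu.analyticAt z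
        have h0 := Filter.codiscreteWithin_mono (Set.subset_univ (Metric.sphere c |R|))
          (han.preimage_zero_mem_codiscrete (x := c) hc)
        filter_upwards [h0] with z hz
        have hz : u z ≠ 0 := hz
        simp [g, hz]
      rw [Real.circleAverage_congr_codiscreteWithin hdis hR.ne']
      refine Real.circleAverage_mono_on_of_le_circle
        ((i1.add i2).congr_codiscreteWithin hdis) fun z hz => ?_
      by_cases h0 : u z = 0
      · simp [g, h0]
      · simp only [g, h0, if_false]
        have hp : 0 < ‖u z‖ := norm_pos_iff.2 h0
        have h1 := Real.log_le_log (by positivity) (hK z)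
        rw [Real.log_mul hp.ne' (Real.exp_pos _).ne', Real.log_mul hKpos.ne' (Real.exp_pos _).ne',
          Real.log_exp, Real.log_exp] at h1
        refine h1.trans ?_
        have h2 : ‖z‖ ≤ R + ‖c‖ := by
          rw [abs_of_pos hR, mem_sphere_iff_norm] at hz
          rw [← hz]
          simpa using norm_add_le (z - c) c
        have h3 : ‖z‖ ^ 2 ≤ (R + ‖c‖) ^ 2 := by gcongr
        simp only [C]
        linarith
    rw [Real.circleAverage_fun_add i1 i2] at hle
    have h1 := log_norm_le_circleAverage hu hc hR
    have h2 := le_abs_self (2 * (Real.log K - Real.log ‖u c‖))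
    linarith
  -- `2 s |ψ| ≤ s² + |ψ|²` stands in for the Cauchy-Schwarz inequality between the first and second
  -- means.
  have hamgm : Real.circleAverage (fun z => (2 * s) • ‖ψ z‖) c R
      ≤ Real.circleAverage (fun z => s ^ 2 + (2 : ℝ) • (‖ψ z‖ ^ 2 / 2)) c R := by
    refine Real.circleAverage_mono (circleIntegrable_of_continuous (by fun_prop))
      (circleIntegrable_of_continuous (by fun_prop)) fun z _ => ?_
    simp only [smul_eq_mul]
    nlinarith [sq_nonneg (s - ‖ψ z‖)]
  rw [Real.circleAverage_fun_smul, Real.circleAverage_fun_add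
    (circleIntegrable_of_continuous (by fun_prop)) (circleIntegrable_of_continuous (by fun_prop)),
    Real.circleAverage_const, Real.circleAverage_fun_smul] at hamgm
  simp only [smul_eq_mul] at hamgm
  nlinarith

/-- An entire function whose means over circles grow at most like the radius is affine. -/
theorem exists_affine_of_circleAverage_norm_le {ψ : ℂ → ℂ} (hψ : Differentiable ℂ ψ) {c : ℂ}
    {B D : ℝ} (h : ∀ R, 0 < R →
      Real.circleAverage (fun z => ‖ψ z‖) c R ≤ Real.sqrt ((R + D) ^ 2 + B)) :
    ∃ a b : ℂ, ‖a‖ ≤ 1 ∧ ∀ z, ψ z = a * z + b := by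
  have hlim : Filter.Tendsto (fun R : ℝ => Real.sqrt ((R + D) ^ 2 + B) * R⁻¹) Filter.atTop
      (nhds 1) := by
    have hi := tendsto_inv_atTop_zero (𝕜 := ℝ)
    have h1 : Filter.Tendsto (fun R : ℝ => Real.sqrt ((1 + D * R⁻¹) ^ 2 + B * R⁻¹ ^ 2))
        Filter.atTop (nhds (Real.sqrt ((1 + D * 0) ^ 2 + B * 0 ^ 2))) :=
      (((tendsto_const_nhds.add (hi.const_mul D)).pow 2).add ((hi.pow 2).const_mul B)).sqrt
    simp only [mul_zero, add_zero, one_pow, ne_eq, OfNat.ofNat_ne_zero, not_false_eq_true,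
      zero_pow, Real.sqrt_one] at h1
    refine h1.congr' ?_
    filter_upwards [Filter.eventually_gt_atTop 0] with R hR
    have hR' : R⁻¹ = Real.sqrt (R⁻¹ ^ 2) := (Real.sqrt_sq (by positivity)).symm
    conv_rhs => rw [hR', ← Real.sqrt_mul' _ (sq_nonneg _)]
    congr 1
    field_simp
  set q : ℕ → ℂ := fun n => (cauchyPowerSeries ψ c 1).coeff n with hq
  have hball (R : ℝ) (hR : 0 < R) : HasFPowerSeriesOnBall ψ (cauchyPowerSeries ψ c R) c ⊤ :=
    hψ.hasFPowerSeriesOnBall c (R := ⟨R, hR.le⟩) hR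
  have hcoef (n : ℕ) (R : ℝ) (hR : 0 < R) :
      ‖q n‖ ≤ Real.sqrt ((R + D) ^ 2 + B) * R⁻¹ ^ n := by
    -- The Taylor coefficients do not depend on the radius of the Cauchy integral.
    have heq := (hball R hR).hasFPowerSeriesAt.eq_formalMultilinearSeries
      (hball 1 one_pos).hasFPowerSeriesAt
    simp only [hq]
    rw [← heq, ← FormalMultilinearSeries.norm_apply_eq_norm_coef]
    refine (norm_cauchyPowerSeries_le ψ c R n).trans ?_
    rw [abs_of_pos hR]
    gcongr
    have := h R hR
    rwa [Real.circleAverage_def, smul_eq_mul] at this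
  have h1 : ‖q 1‖ ≤ 1 := by
    refine ge_of_tendsto hlim ?_
    filter_upwards [Filter.eventually_gt_atTop 0] with R hR
    simpa using hcoef 1 R hR
  have h2 (n : ℕ) : q (n + 2) = 0 := by
    rw [← norm_le_zero_iff]
    have hlim2 := hlim.mul ((tendsto_inv_atTop_zero (𝕜 := ℝ)).pow (n + 1))
    rw [zero_pow (by omega), mul_zero] at hlim2
    refine ge_of_tendsto hlim2 ?_
    filter_upwards [Filter.eventually_gt_atTop 0] with R hR
    refine (hcoef (n + 2) R hR).trans_eq ?_
    ring
  refine ⟨q 1, q 0 - q 1 * c, h1, fun z => ?_⟩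
  have hsum := (hball 1 one_pos).hasSum_sub (y := z) (by simp)
  simp only [FormalMultilinearSeries.apply_eq_pow_smul_coeff] at hsum
  rw [← hsum.tsum_eq, tsum_eq_sum (s := {0, 1})]
  · simp [hq]; ring
  · intro n hn
    obtain ⟨m, rfl⟩ : ∃ m, n = m + 2 := ⟨n - 2, by simp at hn; omega⟩
    change _ • q (m + 2) = 0
    rw [h2, smul_zero]

/-! ### Polynomials, point evaluations and completeness of the Fock space. -/

/-- An entire function dominated by `exp(|z|²/4)` belongs to every `F_p`. -/
theorem memFock_of_norm_le {p : ℝ} (hp : 1 ≤ p) {f : ℂ → ℂ} (hf : Differentiable ℂ f) {C : ℝ}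
    (hC : ∀ z, ‖f z‖ ≤ C * Real.exp (‖z‖ ^ 2 / 4)) : MemFock p f := by
  refine ⟨hf, ?_⟩
  have hC0 : 0 ≤ C := by
    have := (norm_nonneg _).trans (hC 0)
    simpa using this
  have hg : Integrable (fun z : ℂ => C ^ p * Real.exp (-(p / 4) * ‖z‖ ^ 2)) := by
    refine Integrable.const_mul ?_ _
    have h := (GaussianFourier.integrable_cexp_neg_mul_sq_norm_add (V := ℂ) (b := (p / 4 : ℝ))
      (by simp; linarith) 0 0).norm
    refine h.congr (Filter.Eventually.of_forall fun z => ?_)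
    simp only [Complex.norm_exp]
    norm_cast
    simp
  refine hg.mono' ?_ (Filter.Eventually.of_forall fun z => ?_)
  · have := hf.continuous
    refine Continuous.aestronglyMeasurable ?_
    refine Continuous.mul (this.norm.rpow_const fun _ => Or.inr (by linarith)) (by fun_prop)
  · rw [Real.norm_of_nonneg (by positivity)]
    calc ‖f z‖ ^ p * Real.exp (-(p * ‖z‖ ^ 2 / 2))
        ≤ (C * Real.exp (‖z‖ ^ 2 / 4)) ^ p * Real.exp (-(p * ‖z‖ ^ 2 / 2)) := by
          gcongr
          exact hC z
      _ = C ^ p * Real.exp (-(p / 4) * ‖z‖ ^ 2) := by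
          rw [Real.mul_rpow hC0 (Real.exp_pos _).le, ← Real.exp_mul, mul_assoc, ← Real.exp_add]
          congr 2
          ring

theorem memFock_pow {p : ℝ} (hp : 1 ≤ p) (n : ℕ) : MemFock p (fun z => z ^ n) := by
  -- The constant comes from `xⁿ ≤ n! eˣ` and `x ≤ 1 + x²/4`.
  refine memFock_of_norm_le hp (by fun_prop) (C := n.factorial * Real.exp 1) fun z => ?_
  rw [norm_pow, mul_assoc, ← Real.exp_add]
  have h1 := Real.pow_div_factorial_le_exp ‖z‖ (norm_nonneg z) n
  rw [div_le_iff₀ (by positivity)] at h1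
  refine h1.trans ?_
  rw [mul_comm]
  gcongr
  nlinarith [sq_nonneg (‖z‖ - 2)]

theorem memFock_polynomial {p : ℝ} (hp : 1 ≤ p) (P : Polynomial ℂ) :
    MemFock p (fun z => P.eval z) := by
  have : Fact (1 ≤ p) := ⟨hp⟩
  induction P using Polynomial.induction_on' with
  | add P Q hP hQ =>
    have := (fockSubmodule p).add_mem (x := fun z => P.eval z) (y := fun z => Q.eval z) hP hQ
    simp only [Polynomial.eval_add]
    exact this
  | monomial n a =>
    have := (fockSubmodule p).smul_mem a (x := fun z : ℂ => z ^ n) (memFock_pow hp n)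
    simp only [Polynomial.eval_monomial]
    exact this

namespace Fock

variable {p : ℝ} [Fact (1 ≤ p)]

/-- Polynomials as elements of `F_p`. -/
noncomputable def ofPolynomial : Polynomial ℂ →ₗ[ℂ] Fock p where
  toFun P := mk (fun z => P.eval z) (memFock_polynomial Fact.out P)
  map_add' P Q := DFunLike.coe_injective (funext fun z => by simp [coe_mk, coe_add])
  map_smul' c P := DFunLike.coe_injective (funext fun z => by simp [coe_mk, coe_smul])

theorem ofPolynomial_apply (P : Polynomial ℂ) (z : ℂ) :
    ofPolynomial (p := p) P z = P.eval z := rfl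

theorem ofPolynomial_injective : Function.Injective (ofPolynomial (p := p)) := fun P Q h =>
  Polynomial.funext fun z => by rw [← ofPolynomial_apply (p := p), h, ofPolynomial_apply]

instance : Nontrivial (Fock p) := ofPolynomial_injective.nontrivial

theorem not_finiteDimensional : ¬ FiniteDimensional ℂ (Fock p) := fun _ =>
  Polynomial.not_finite (R := ℂ) (Module.Finite.of_injective _ (ofPolynomial_injective (p := p)))

/-- The value at `0` is a mean over the unit disc, where the weight is at least `exp(-1/2)`;
Hölder's inequality on this finite measure passes from `L¹` to `Lᵖ`. -/
theorem exists_norm_apply_zero_le :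
    ∃ C : ℝ, 0 < C ∧ ∀ f : Fock p, ‖f 0‖ ≤ C * ‖f‖ := by
  have hp : 1 ≤ p := Fact.out
  set S := Metric.ball (0 : ℂ) 1
  set K : ℝ := (((volume.restrict S) Set.univ : ENNReal) ^
    (1 / (1 : ENNReal).toReal - 1 / (ENNReal.ofReal p).toReal)).toReal with hK
  have hfin : IsFiniteMeasure (volume.restrict S) := ⟨by simp [S]⟩
  set q : ℝ := (p / (2 * Real.pi)) ^ (1 / p) with hq
  have hq0 : 0 < q := by positivity
  refine ⟨Real.exp (1 / 2) * (K + 1) / q, by positivity, fun f => ?_⟩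
  have hmem := ((memFock_iff_memLp hp).1 f.memFock).2
  set N := (eLpNorm (fockWeighted f) (ENNReal.ofReal p) volume).toReal with hN
  have hnorm : ‖f‖ = q * N := fockNorm_eq hp f.memFock
  have hfw := continuous_fockWeighted f.differentiable
  have hL1 : (eLpNorm (fockWeighted f) 1 (volume.restrict S)).toReal ≤ N * K := by
    rw [hN, hK, ← ENNReal.toReal_mul]
    refine ENNReal.toReal_mono (ENNReal.mul_ne_top hmem.2.ne ?_) ?_
    · refine ENNReal.rpow_ne_top_of_nonneg ?_ (measure_ne_top _ _)
      rw [ENNReal.toReal_ofReal (by linarith), ENNReal.toReal_one, sub_nonneg]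
      rw [div_le_div_iff₀ (by linarith) one_pos]
      linarith
    · refine (eLpNorm_le_eLpNorm_mul_rpow_measure_univ (q := ENNReal.ofReal p) (by simpa using hp)
        hfw.aestronglyMeasurable).trans ?_
      gcongr
      exact Measure.restrict_le_self
  have hint : ∫ z in S, ‖fockWeighted f z‖ ≤ N * K := by
    refine le_trans (le_of_eq ?_) hL1
    rw [eLpNorm_one_eq_lintegral_enorm, integral_norm_eq_lintegral_enorm hfw.aestronglyMeasurable]
  have hpi : Real.pi * ‖f 0‖ ≤ Real.exp (1 / 2) * (N * K) := by
    calc Real.pi * ‖f 0‖ = ‖∫ z in S, f z‖ := by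
          rw [integral_ball_of_differentiable f.differentiable, norm_mul, Complex.norm_real,
            Real.norm_of_nonneg Real.pi_pos.le]
      _ ≤ ∫ z in S, Real.exp (1 / 2) * ‖fockWeighted f z‖ := by
          refine norm_integral_le_of_norm_le ?_ ?_
          · refine Integrable.const_mul (Integrable.norm ?_) _
            exact (hfw.continuousOn.integrableOn_compact (isCompact_closedBall (0 : ℂ) 1)).mono_set
              Metric.ball_subset_closedBall
          · refine (ae_restrict_iff' measurableSet_ball).2 (Filter.Eventually.of_forall
              fun z hz => ?_)
            simp only [Metric.mem_ball, dist_zero_right] at hz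
            rw [fockWeighted, norm_mul, Complex.norm_real, Real.norm_of_nonneg (Real.exp_pos _).le,
              mul_left_comm, ← Real.exp_add]
            refine le_mul_of_one_le_right (norm_nonneg _) (Real.one_le_exp ?_)
            nlinarith [norm_nonneg z]
      _ ≤ Real.exp (1 / 2) * (N * K) := by
          rw [integral_const_mul]
          gcongr
  have h3 := Real.pi_gt_three
  have hN0 : 0 ≤ N := ENNReal.toReal_nonneg
  calc ‖f 0‖ ≤ Real.pi * ‖f 0‖ := le_mul_of_one_le_left (norm_nonneg _) (by linarith)
    _ ≤ Real.exp (1 / 2) * (N * K) := hpi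
    _ ≤ Real.exp (1 / 2) * (N * (K + 1)) := by gcongr; linarith
    _ = Real.exp (1 / 2) * (K + 1) / q * ‖f‖ := by rw [hnorm]; field_simp

/-- Point evaluations are bounded on `F_p`, with norm at most a multiple of `exp(|z|²/2)`. -/
theorem exists_norm_apply_le :
    ∃ C : ℝ, 0 < C ∧ ∀ (f : Fock p) (z : ℂ), ‖f z‖ ≤ C * Real.exp (‖z‖ ^ 2 / 2) * ‖f‖ := by
  obtain ⟨C, hC, h⟩ := exists_norm_apply_zero_le (p := p)
  refine ⟨C, hC, fun f z => ?_⟩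
  -- This isometry moves `z` to the origin: its value at `0` is `exp(-|z|²/2) f(z)`.
  have h1 := h (weyl 1 norm_one z f)
  rw [LinearIsometryEquiv.norm_map, weyl_apply] at h1
  simp only [mul_zero, neg_zero, zero_sub, zero_add, norm_mul, Complex.norm_exp,
    Complex.neg_re, Complex.ofReal_re] at h1
  have h2 : ‖f z‖ = Real.exp (‖z‖ ^ 2 / 2) * (Real.exp (-(‖z‖ ^ 2 / 2)) * ‖f z‖) := by
    rw [← mul_assoc, ← Real.exp_add]; simp
  rw [h2, mul_right_comm, mul_comm]
  gcongr

theorem norm_eq_eLpNorm (f : Fock p) : ‖f‖ = (p / (2 * Real.pi)) ^ (1 / p) *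
    (eLpNorm (fockWeighted f) (ENNReal.ofReal p) volume).toReal :=
  fockNorm_eq Fact.out f.memFock

/-- Bounded evaluations make a Cauchy sequence converge locally uniformly, so the limit is entire;
Fatou's lemma upgrades this to norm convergence. -/
instance instCompleteSpace : CompleteSpace (Fock p) := by
  have hp : 1 ≤ p := Fact.out
  obtain ⟨C, hC, hpt⟩ := exists_norm_apply_le (p := p)
  set q : ℝ := (p / (2 * Real.pi)) ^ (1 / p) with hq
  have hq0 : 0 < q := by positivity
  refine Metric.complete_of_cauchySeq_tendsto fun F hF => ?_
  have hpc (z : ℂ) : CauchySeq fun n => F n z := by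
    rw [Metric.cauchySeq_iff] at hF ⊢
    intro ε hε
    obtain ⟨N, hN⟩ := hF (ε / (C * Real.exp (‖z‖ ^ 2 / 2))) (by positivity)
    refine ⟨N, fun m hm n hn => ?_⟩
    have h1 := hN m hm n hn
    rw [dist_eq_norm, lt_div_iff₀ (by positivity), mul_comm] at h1
    rw [dist_eq_norm]
    exact (hpt (F m - F n) z).trans_lt h1
  choose g hg using fun z => cauchySeq_tendsto_of_complete (hpc z)
  have hlu : TendstoLocallyUniformlyOn (fun n z => F n z) g Filter.atTop Set.univ := by
    rw [tendstoLocallyUniformlyOn_iff_forall_isCompact isOpen_univ]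
    intro K _ hK
    obtain ⟨R, hR0, hR⟩ := hK.isBounded.subset_closedBall_lt 0 0
    have hu : UniformCauchySeqOn (fun n z => F n z) Filter.atTop K := by
      rw [Metric.uniformCauchySeqOn_iff]
      intro ε hε
      rw [Metric.cauchySeq_iff] at hF
      obtain ⟨N, hN⟩ := hF (ε / (C * Real.exp (R ^ 2 / 2))) (by positivity)
      refine ⟨N, fun m hm n hn z hz => ?_⟩
      have h1 := hN m hm n hn
      rw [dist_eq_norm, lt_div_iff₀ (by positivity), mul_comm] at h1
      rw [dist_eq_norm]
      refine (hpt (F m - F n) z).trans_lt (lt_of_le_of_lt ?_ h1)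
      have hzR : ‖z‖ ≤ R := by simpa using hR hz
      gcongr
    exact hu.tendstoUniformlyOn_of_tendsto fun z _ => hg z
  have hgd : Differentiable ℂ g := by
    rw [← differentiableOn_univ]
    exact hlu.differentiableOn (Filter.Eventually.of_forall fun n =>
      (F n).differentiable.differentiableOn) isOpen_univ
  have hfatou (ε : ℝ) (hε : 0 < ε) : ∃ N, ∀ n ≥ N,
      eLpNorm (fockWeighted (F n - g)) (ENNReal.ofReal p) volume ≤ ENNReal.ofReal ε := by
    rw [Metric.cauchySeq_iff] at hF
    obtain ⟨N, hN⟩ := hF (q * ε) (by positivity)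
    refine ⟨N, fun n hn => ?_⟩
    refine (Lp.eLpNorm_lim_le_liminf_eLpNorm (f := fun m => fockWeighted (F n - F m))
      (fun m => (continuous_fockWeighted
        ((F n).differentiable.sub (F m).differentiable)).aestronglyMeasurable) _
      (Filter.Eventually.of_forall fun z => ?_)).trans ?_
    · exact ((hg z).const_sub (F n z)).mul_const _
    · refine Filter.liminf_le_of_frequently_le' (Filter.Eventually.frequently ?_)
      filter_upwards [Filter.eventually_ge_atTop N] with m hm
      have h1 := hN n hn m hm
      rw [dist_eq_norm, norm_eq_eLpNorm, ← hq] at h1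
      have h2 := lt_of_mul_lt_mul_left h1 hq0.le
      refine ENNReal.le_ofReal_iff_toReal_le ?_ hε.le |>.2 h2.le
      exact ((memFock_iff_memLp hp).1 (F n - F m).memFock).2.2.ne
  have hgm : MemFock p g := by
    obtain ⟨N, hN⟩ := hfatou 1 one_pos
    have h1 : MemFock p (F N - g) := (memFock_iff_memLp hp).2
      ⟨(F N).differentiable.sub hgd,
        (continuous_fockWeighted ((F N).differentiable.sub hgd)).aestronglyMeasurable,
        (hN N le_rfl).trans_lt ENNReal.ofReal_lt_top⟩
    have h2 := (fockSubmodule p).sub_mem (F N).memFock h1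
    have h3 : (⇑(F N) - (⇑(F N) - g)) = g := by simp
    rw [h3] at h2
    exact h2
  refine ⟨mk g hgm, Metric.tendsto_atTop.2 fun ε hε => ?_⟩
  obtain ⟨N, hN⟩ := hfatou (ε / (2 * q)) (by positivity)
  refine ⟨N, fun n hn => ?_⟩
  rw [dist_eq_norm, norm_eq_eLpNorm, ← hq]
  have h1 := ENNReal.toReal_mono ENNReal.ofReal_ne_top (hN n hn)
  rw [ENNReal.toReal_ofReal (by positivity)] at h1
  calc q * (eLpNorm (fockWeighted (F n - g)) (ENNReal.ofReal p) volume).toReal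
      ≤ q * (ε / (2 * q)) := by gcongr
    _ = ε / 2 := by field_simp
    _ < ε := by linarith

end Fock

/-! ### Abstract spectral criteria. -/

/-- A compact operator whose eigenvalues lie in the open unit disc satisfies Ritt's condition. -/
theorem IsCompactOperator.rittCondition {X : Type*} [NormedAddCommGroup X] [NormedSpace ℂ X]
    [CompleteSpace X] {T : X →L[ℂ] X} (hT : IsCompactOperator T)
    (h : ∀ (lam : ℂ) (x : X), T x = lam • x → x ≠ 0 → ‖lam‖ < 1) : RittCondition T := by
  refine rittCondition_of_forall_mem_resolventSet fun lam hlam => ?_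
  have h0 : lam ≠ 0 := by
    rintro rfl
    norm_num at hlam
  -- The Fredholm alternative for compact operators.
  refine (hT.hasEigenvalue_or_mem_resolventSet h0).resolve_left fun hev => ?_
  obtain ⟨x, hx⟩ := hev.exists_hasEigenvector
  exact (h lam x hx.apply_eq_smul hx.2).not_ge hlam

theorem exists_sub_apply_eq_of_mem_resolventSet {X : Type*} [NormedAddCommGroup X]
    [NormedSpace ℂ X] {T : X →L[ℂ] X} {μ : ℂ} (h : μ ∈ resolventSet ℂ T) (y : X) :
    ∃ x, μ • x - T x = y := by
  refine ⟨resolvent T μ y, ?_⟩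
  have h2 := congrArg (fun S : X →L[ℂ] X => S y)
    (Ring.mul_inverse_cancel _ (spectrum.mem_resolventSet_iff.1 h))
  rw [Algebra.algebraMap_eq_smul_one] at h2
  simpa [resolvent, Algebra.algebraMap_eq_smul_one] using h2

/-- `μ - cV = -c V (1 - (μ/c) V⁻¹)`, and the last factor is inverted by a Neumann series. -/
theorem mem_resolventSet_of_norm_lt_of_isometry {X : Type*} [NormedAddCommGroup X]
    [NormedSpace ℂ X] [CompleteSpace X] [Nontrivial X] (V : X ≃ₗᵢ[ℂ] X) {c μ : ℂ}
    (h : ‖μ‖ < ‖c‖) :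
    μ ∈ resolventSet ℂ (c • V.toContinuousLinearEquiv.toContinuousLinearMap) := by
  have hc : c ≠ 0 := norm_pos_iff.1 ((norm_nonneg μ).trans_lt h)
  set U : (X →L[ℂ] X)ˣ := V.toContinuousLinearEquiv.toUnit
  set Y : X →L[ℂ] X := V.symm.toContinuousLinearEquiv.toContinuousLinearMap
  have hY : (U : X →L[ℂ] X) * Y = 1 := by
    ext x
    exact V.apply_symm_apply x
  have hYn : ‖Y‖ ≤ 1 := Y.opNorm_le_bound zero_le_one fun x => by
    rw [one_mul]
    exact (V.symm.norm_map x).le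
  have hlt : ‖(μ / c) • Y‖ < 1 := by
    rw [norm_smul, norm_div]
    refine (mul_le_of_le_one_right (by positivity) hYn).trans_lt ?_
    rwa [div_lt_one (norm_pos_iff.2 hc)]
  have hfac : algebraMap ℂ (X →L[ℂ] X) μ - c • V.toContinuousLinearEquiv.toContinuousLinearMap
      = (-c) • ((U : X →L[ℂ] X) * (1 - (μ / c) • Y)) := by
    rw [mul_sub, mul_one, mul_smul_comm, hY, smul_sub, smul_smul, neg_mul, mul_div_cancel₀ _ hc,
      Algebra.algebraMap_eq_smul_one, neg_smul, neg_smul, sub_neg_eq_add, add_comm,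
      ← sub_eq_add_neg]
    rfl
  rw [spectrum.mem_resolventSet_iff, hfac]
  exact (U.isUnit.mul (isUnit_one_sub_of_norm_lt_one hlt)).smul (Units.mk0 (-c) (neg_ne_zero.2 hc))

/-! ### Spectra of weighted composition operators. -/

namespace IsWeightedComposition

variable {p : ℝ} [Fact (1 ≤ p)] {u ψ : ℂ → ℂ} {W : Fock p →L[ℂ] Fock p}

theorem exists_norm_mul_exp_le (hW : IsWeightedComposition u ψ W) :
    ∃ K : ℝ, ∀ z, ‖u z‖ * Real.exp (‖ψ z‖ ^ 2 / 2) ≤ K * Real.exp (‖z‖ ^ 2 / 2) := by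
  obtain ⟨C, hC, h⟩ := Fock.exists_norm_apply_le (p := p)
  refine ⟨C * (‖W‖ * ‖(Fock.ofPolynomial 1 : Fock p)‖), fun z => ?_⟩
  -- The normalised kernel at `ψ z`: its norm does not depend on `z`, and its value at `ψ z` is
  -- `exp(|ψ z|²/2)`.
  set f : Fock p := Fock.weyl 1 norm_one (-ψ z) (Fock.ofPolynomial 1) with hf
  have h1 := h (W f) z
  have h2 : ‖W f‖ ≤ ‖W‖ * ‖(Fock.ofPolynomial 1 : Fock p)‖ := by
    refine (W.le_opNorm f).trans_eq ?_
    rw [hf, LinearIsometryEquiv.norm_map]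
  have h3 : ‖f (ψ z)‖ = Real.exp (‖ψ z‖ ^ 2 / 2) := by
    rw [hf, Fock.weyl_apply, Fock.ofPolynomial_apply, Polynomial.eval_one, mul_one,
      Complex.norm_exp, map_neg, one_mul, neg_mul, neg_neg, Complex.conj_mul', norm_neg]
    congr 1
    norm_cast
    ring
  rw [hW, norm_mul, h3] at h1
  refine h1.trans ?_
  rw [mul_right_comm]
  gcongr

theorem exists_affine (hW : IsWeightedComposition u ψ W) (hu : Differentiable ℂ u)
    (hψ : Differentiable ℂ ψ) (h0 : u ≠ 0) : ∃ a b : ℂ, ‖a‖ ≤ 1 ∧ ∀ z, ψ z = a * z + b := by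
  obtain ⟨K, hK⟩ := hW.exists_norm_mul_exp_le
  obtain ⟨c, hc⟩ := Function.ne_iff.1 h0
  obtain ⟨B, _, hB⟩ := circleAverage_norm_le hu hψ hK hc
  exact exists_affine_of_circleAverage_norm_le hψ hB

/-- If `|a| = 1`, then `W` is a multiple of a Weyl operator. -/
theorem eq_smul_weyl (hW : IsWeightedComposition u ψ W) (hu : Differentiable ℂ u) {a b : ℂ}
    (ha : ‖a‖ = 1) (hψ : ∀ z, ψ z = a * z + b) :
    W = (u 0 * Complex.exp ((‖b‖ ^ 2 / 2 : ℝ) : ℂ)) •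
      (Fock.weyl (p := p) a ha b).toContinuousLinearEquiv.toContinuousLinearMap := by
  obtain ⟨K, hK⟩ := hW.exists_norm_mul_exp_le
  have hd : Differentiable ℂ fun z => u z * Complex.exp (a * starRingEnd ℂ b * z) := by fun_prop
  -- For `|a| = 1` the kernel estimate bounds this entire function, so it is constant by Liouville's
  -- theorem.
  have hbd : Bornology.IsBounded
      (Set.range fun z => u z * Complex.exp (a * starRingEnd ℂ b * z)) := by
    refine isBounded_iff_forall_norm_le.2 ⟨K * Real.exp (-(‖b‖ ^ 2 / 2)), ?_⟩
    rintro _ ⟨z, rfl⟩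
    have h1 := hK z
    have h2 : ‖ψ z‖ ^ 2 / 2 = (a * starRingEnd ℂ b * z).re + (‖z‖ ^ 2 / 2 + ‖b‖ ^ 2 / 2) := by
      rw [hψ, norm_mul_add_sq ha]
      ring
    rw [h2, Real.exp_add, Real.exp_add] at h1
    rw [norm_mul, Complex.norm_exp, Real.exp_neg, ← div_eq_mul_inv, le_div_iff₀ (Real.exp_pos _)]
    refine le_of_mul_le_mul_right ?_ (Real.exp_pos (‖z‖ ^ 2 / 2))
    linarith
  ext f
  refine DFunLike.coe_injective (funext fun z => ?_)
  have h := hd.apply_eq_apply_of_bounded hbd z 0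
  simp only [mul_zero, Complex.exp_zero, mul_one] at h
  have hcoe : (((u 0 * Complex.exp ((‖b‖ ^ 2 / 2 : ℝ) : ℂ)) •
      (Fock.weyl (p := p) a ha b).toContinuousLinearEquiv.toContinuousLinearMap) f) z
      = (u 0 * Complex.exp ((‖b‖ ^ 2 / 2 : ℝ) : ℂ)) * Fock.weyl a ha b f z := rfl
  rw [hW, hψ, hcoe, Fock.weyl_apply, ← h, ← mul_assoc]
  congr 1
  rw [mul_assoc, mul_assoc, ← Complex.exp_add, ← Complex.exp_add]
  ring_nf
  simp

/-- Every function in the range of `u(z₀) - W` vanishes at `z₀`, so `1` is not in the range. -/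
theorem apply_mem_spectrum_of_fixed (hW : IsWeightedComposition u ψ W) {z₀ : ℂ}
    (hz : ψ z₀ = z₀) : u z₀ ∈ spectrum ℂ W := by
  intro h
  obtain ⟨f, hf⟩ := exists_sub_apply_eq_of_mem_resolventSet h (Fock.ofPolynomial 1)
  have h1 := congrArg (fun g : Fock p => g z₀) hf
  simp [Fock.coe_sub, Fock.coe_smul, hW f, hz, Fock.ofPolynomial_apply] at h1

/-- Unless `a u(z₀) = u(z₀)`, a preimage `f` of `z - z₀` under `a u(z₀) - W` vanishes at `z₀`. The
two terms in `f'(z₀)` then cancel, so the image has derivative `0` at `z₀` instead of `1`. -/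
theorem mul_apply_mem_spectrum_of_fixed (hW : IsWeightedComposition u ψ W)
    (hu : Differentiable ℂ u) {a b z₀ : ℂ} (hψ : ∀ z, ψ z = a * z + b) (hz : ψ z₀ = z₀) :
    a * u z₀ ∈ spectrum ℂ W := by
  by_cases heq : a * u z₀ = u z₀
  · rw [heq]
    exact hW.apply_mem_spectrum_of_fixed hz
  intro h
  obtain ⟨f, hf⟩ := exists_sub_apply_eq_of_mem_resolventSet h
    (Fock.ofPolynomial (Polynomial.X - Polynomial.C z₀))
  have h1 (z : ℂ) : a * u z₀ * f z - u z * f (a * z + b) = z - z₀ := by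
    have := congrArg (fun g : Fock p => g z) hf
    simpa [Fock.coe_sub, Fock.coe_smul, hW f, hψ, Fock.ofPolynomial_apply] using this
  have hz' : a * z₀ + b = z₀ := by rw [← hψ, hz]
  have hf0 : f z₀ = 0 := by
    have h2 := h1 z₀
    rw [hz', sub_self, ← sub_mul] at h2
    exact (mul_eq_zero.1 h2).resolve_left (sub_ne_zero.2 heq)
  have hfd : HasDerivAt f (deriv f z₀) z₀ := (f.differentiable z₀).hasDerivAt
  have hlin : HasDerivAt (fun z => a * z + b) a z₀ := by
    simpa using ((hasDerivAt_id z₀).const_mul a).add_const b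
  have hcomp : HasDerivAt (fun z => f (a * z + b)) (deriv f z₀ * a) z₀ :=
    HasDerivAt.comp (h₂ := f) z₀ (by rwa [hz']) hlin
  have hL := (hfd.const_mul (a * u z₀)).sub ((hu z₀).hasDerivAt.mul hcomp)
  have hR : HasDerivAt (fun z => z - z₀) 1 z₀ := (hasDerivAt_id z₀).sub_const z₀
  have hfun : ((fun z => a * u z₀ * f z) - u * fun z => f (a * z + b)) = fun z => z - z₀ :=
    funext h1
  rw [hfun] at hL
  have h3 := hL.unique hR
  rw [hz', hf0] at h3
  have h4 : (0 : ℂ) = 1 := by rw [← h3]; ring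
  exact zero_ne_one h4

theorem rittCondition_of_norm_lt (hW : IsWeightedComposition u ψ W) (hu : Differentiable ℂ u)
    {a b : ℂ} (ha : ‖a‖ = 1) (hψ : ∀ z, ψ z = a * z + b)
    (h : ‖u 0‖ < Real.exp (-‖b‖ ^ 2 / 2)) : RittCondition W := by
  refine rittCondition_of_forall_mem_resolventSet fun lam hlam =>
    spectrum.mem_resolventSet_of_norm_lt (lt_of_lt_of_le ?_ hlam)
  rw [hW.eq_smul_weyl hu ha hψ, norm_smul, norm_mul, Complex.norm_exp, Complex.ofReal_re]
  have hV : ‖(Fock.weyl (p := p) a ha b).toContinuousLinearEquiv.toContinuousLinearMap‖ ≤ 1 :=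
    ContinuousLinearMap.opNorm_le_bound _ zero_le_one fun f => by
      rw [one_mul]
      exact ((Fock.weyl a ha b).norm_map f).le
  refine (mul_le_of_le_one_right (by positivity) hV).trans_lt ?_
  calc ‖u 0‖ * Real.exp (‖b‖ ^ 2 / 2)
      < Real.exp (-‖b‖ ^ 2 / 2) * Real.exp (‖b‖ ^ 2 / 2) := by gcongr
    _ = 1 := by rw [← Real.exp_add, neg_div, neg_add_cancel, Real.exp_zero]

theorem rittCondition_of_eq_one (hW : IsWeightedComposition u ψ W) (hu : Differentiable ℂ u)
    (hψ : ∀ z, ψ z = z) (h0 : u 0 = 1) : RittCondition W := by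
  have hW1 : W = 1 := by
    rw [hW.eq_smul_weyl (a := 1) (b := 0) hu norm_one (by simpa using hψ), h0]
    ext f
    refine DFunLike.coe_injective (funext fun z => ?_)
    simp [Fock.weyl_apply]
  refine ⟨1, one_pos, fun lam hlam => ?_⟩
  have hne : lam - 1 ≠ 0 := by
    rw [sub_ne_zero]
    rintro rfl
    simp at hlam
  have heq : algebraMap ℂ (Fock p →L[ℂ] Fock p) lam - W
      = ((Units.mk0 (lam - 1) hne • 1 : (Fock p →L[ℂ] Fock p)ˣ) : Fock p →L[ℂ] Fock p) := by
    rw [hW1, Algebra.algebraMap_eq_smul_one]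
    simp [sub_smul, Units.smul_def]
  refine ⟨by rw [spectrum.mem_resolventSet_iff, heq]; exact Units.isUnit _, ?_⟩
  rw [resolvent, heq, Ring.inverse_unit]
  simp [Units.smul_def, norm_smul]

theorem norm_lt_of_rittCondition_of_translation (hW : IsWeightedComposition u ψ W)
    (hu : Differentiable ℂ u) {b : ℂ} (hb : b ≠ 0) (hψ : ∀ z, ψ z = 1 * z + b)
    (hR : RittCondition W) : ‖u 0‖ < Real.exp (-‖b‖ ^ 2 / 2) := by
  by_contra! hle
  set c := u 0 * Complex.exp ((‖b‖ ^ 2 / 2 : ℝ) : ℂ) with hc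
  have hWc := hW.eq_smul_weyl hu norm_one hψ
  have hc1 : 1 ≤ ‖c‖ := by
    rw [hc, norm_mul, Complex.norm_exp, Complex.ofReal_re]
    calc (1 : ℝ) = Real.exp (-‖b‖ ^ 2 / 2) * Real.exp (‖b‖ ^ 2 / 2) := by
          rw [← Real.exp_add, neg_div, neg_add_cancel, Real.exp_zero]
      _ ≤ _ := by gcongr
  have hone {μ : ℂ} (hμ : μ ∈ spectrum ℂ W) : μ = 1 := by
    refine (hR.norm_lt_one_or_eq_one hμ).resolve_left fun hlt => ?_
    rw [hWc] at hμ
    exact hμ (mem_resolventSet_of_norm_lt_of_isometry _ (hlt.trans_le hc1))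
  obtain ⟨μ, hμ⟩ := spectrum.nonempty W
  have h1 : (1 : ℂ) ∈ spectrum ℂ W := hone hμ ▸ hμ
  -- Chosen so that `b̄ w = iπ/2`: exchanging the two translations then costs the phase `exp(-iπ) =
  -- -1`.
  set w : ℂ := Complex.I * Real.pi * b / (2 * (‖b‖ ^ 2 : ℝ)) with hw
  set U : (Fock p →L[ℂ] Fock p)ˣ :=
    (Fock.weyl 1 norm_one w).toContinuousLinearEquiv.toUnit with hU
  have hb2 : ((‖b‖ : ℝ) : ℂ) ≠ 0 := by
    exact_mod_cast (norm_pos_iff.2 hb).ne'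
  have hbw : starRingEnd ℂ b * w = Complex.I * Real.pi / 2 := by
    have hbb := Complex.conj_mul' b
    rw [hw]
    push_cast
    field_simp
    linear_combination hbb
  have hwb : starRingEnd ℂ w * b = -(Complex.I * Real.pi / 2) := by
    have h2 := congrArg (starRingEnd ℂ) hbw
    simp only [map_mul, Complex.conj_conj, map_div₀, Complex.conj_I, Complex.conj_ofReal,
      map_ofNat] at h2
    rw [mul_comm, h2]
    ring
  have hanti : (U : Fock p →L[ℂ] Fock p) * W = -(W * U) := by
    ext f
    refine DFunLike.coe_injective (funext fun z => ?_)
    have hL : ((U : Fock p →L[ℂ] Fock p) * W) f z = c * (Fock.weyl 1 norm_one w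
      (Fock.weyl 1 norm_one b f) z) := by
      rw [hWc, mul_smul_comm]; rfl
    have hRr : (-(W * (U : Fock p →L[ℂ] Fock p))) f z = -(c * (Fock.weyl 1 norm_one b
      (Fock.weyl 1 norm_one w f) z)) := by
      rw [hWc, smul_mul_assoc]; rfl
    rw [hL, hRr]
    simp only [Fock.weyl_apply, one_mul]
    have e1 : z + w + b = z + b + w := by ring
    have e2 : -(starRingEnd ℂ w * z) - ((‖w‖ ^ 2 / 2 : ℝ) : ℂ) +
          (-(starRingEnd ℂ b * (z + w)) - ((‖b‖ ^ 2 / 2 : ℝ) : ℂ))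
        = -(starRingEnd ℂ b * z) - ((‖b‖ ^ 2 / 2 : ℝ) : ℂ) +
          (-(starRingEnd ℂ w * (z + b)) - ((‖w‖ ^ 2 / 2 : ℝ) : ℂ)) - Real.pi * Complex.I := by
      linear_combination hwb - hbw
    rw [e1, ← mul_assoc (Complex.exp _), ← mul_assoc (Complex.exp _), ← Complex.exp_add,
      ← Complex.exp_add, e2, Complex.exp_sub, Complex.exp_pi_mul_I]
    ring
  -- Since `U⁻¹ W U = -W`, the spectrum is symmetric under `μ ↦ -μ`.
  have h2 : (-1 : ℂ) ∈ spectrum ℂ W := by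
    intro hres
    apply h1
    rw [spectrum.mem_resolventSet_iff] at hres ⊢
    have h3 : algebraMap ℂ (Fock p →L[ℂ] Fock p) 1 - W
        = -(((U⁻¹ : (Fock p →L[ℂ] Fock p)ˣ) : Fock p →L[ℂ] Fock p) *
          (algebraMap ℂ (Fock p →L[ℂ] Fock p) (-1) - W) * U) := by
      have h4 : ((U⁻¹ : (Fock p →L[ℂ] Fock p)ˣ) : Fock p →L[ℂ] Fock p) * W * U = -W := by
        rw [mul_assoc, ← neg_neg (W * _), ← hanti, mul_neg, ← mul_assoc, Units.inv_mul, one_mul]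
      rw [mul_sub, sub_mul, h4]
      simp [sub_eq_neg_add, add_comm]
    rw [h3]
    exact ((U⁻¹.isUnit.mul hres).mul U.isUnit).neg
  have h3 := hone h2
  norm_num at h3

/-- At a fixed point `|a z₀ + b| = |z₀|` forces `2 Re(a b̄ z₀) = -|b|²`, which fixes the modulus of
the Weyl factor there. -/
theorem norm_apply_fixed_eq {a b z₀ : ℂ} (hW : IsWeightedComposition u ψ W)
    (hu : Differentiable ℂ u) (ha : ‖a‖ = 1) (hψ : ∀ z, ψ z = a * z + b) (hz : ψ z₀ = z₀) :
    ‖u z₀‖ = ‖u 0‖ * Real.exp (‖b‖ ^ 2 / 2) := by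
  have h1 := congrArg (fun T : Fock p →L[ℂ] Fock p => (T (Fock.ofPolynomial 1)) z₀)
    (hW.eq_smul_weyl hu ha hψ)
  have h2 : (u 0 * Complex.exp ((‖b‖ ^ 2 / 2 : ℝ) : ℂ)) *
      Fock.weyl (p := p) a ha b (Fock.ofPolynomial 1) z₀ = u z₀ := by
    refine Eq.trans h1.symm ?_
    simp [hW _ z₀, Fock.ofPolynomial_apply]
  rw [← h2, Fock.weyl_apply, Fock.ofPolynomial_apply]
  have h3 := norm_mul_add_sq ha b z₀
  rw [← hψ, hz] at h3
  simp only [Polynomial.eval_one, mul_one, norm_mul, Complex.norm_exp, Complex.sub_re,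
    Complex.neg_re, Complex.ofReal_re]
  rw [mul_assoc, ← Real.exp_add]
  congr 2
  linarith

theorem norm_lt_of_rittCondition_of_ne_one (hW : IsWeightedComposition u ψ W)
    (hu : Differentiable ℂ u) {a b : ℂ} (ha : ‖a‖ = 1) (ha1 : a ≠ 1)
    (hψ : ∀ z, ψ z = a * z + b) {z₀ : ℂ} (hz : ψ z₀ = z₀) (hR : RittCondition W) :
    ‖u 0‖ < Real.exp (-‖b‖ ^ 2 / 2) := by
  by_contra! hle
  have hc1 : 1 ≤ ‖u z₀‖ := by
    rw [hW.norm_apply_fixed_eq hu ha hψ hz]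
    calc (1 : ℝ) = Real.exp (-‖b‖ ^ 2 / 2) * Real.exp (‖b‖ ^ 2 / 2) := by
          rw [← Real.exp_add, neg_div, neg_add_cancel, Real.exp_zero]
      _ ≤ _ := by gcongr
  have h1 := (hR.norm_lt_one_or_eq_one (hW.apply_mem_spectrum_of_fixed hz)).resolve_left hc1.not_gt
  have h2 := (hR.norm_lt_one_or_eq_one (hW.mul_apply_mem_spectrum_of_fixed hu hψ hz)).resolve_left
    (by rw [norm_mul, ha, one_mul]; exact hc1.not_gt)
  rw [h1, mul_one] at h2
  exact ha1 h2

/-- Otherwise `W` is a nonzero multiple of an invertible isometry, making the identity of an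
infinite-dimensional space compact. -/
theorem norm_ne_one_of_isCompactOperator (hW : IsWeightedComposition u ψ W)
    (hu : Differentiable ℂ u) (h0 : u ≠ 0) {a b : ℂ} (hψ : ∀ z, ψ z = a * z + b)
    (hK : IsCompactOperator W) : ‖a‖ ≠ 1 := by
  intro ha
  have hWc := hW.eq_smul_weyl hu ha hψ
  set c := u 0 * Complex.exp ((‖b‖ ^ 2 / 2 : ℝ) : ℂ)
  have hc : c ≠ 0 := by
    intro hc
    apply h0
    funext z
    have h1 := hW (Fock.ofPolynomial 1) z
    rw [hWc, hc, zero_smul] at h1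
    simpa [Fock.ofPolynomial_apply, Fock.coe_zero] using h1.symm
  have h1 := hK.clm_comp
    (c⁻¹ • (Fock.weyl (p := p) a ha b).symm.toContinuousLinearEquiv.toContinuousLinearMap)
  have h2 : (c⁻¹ • (Fock.weyl (p := p) a ha b).symm.toContinuousLinearEquiv.toContinuousLinearMap) ∘ W
      = id := by
    funext f
    rw [hWc]
    change c⁻¹ • (Fock.weyl a ha b).symm (c • Fock.weyl a ha b f) = f
    rw [map_smul, smul_smul, inv_mul_cancel₀ hc, one_smul, LinearIsometryEquiv.symm_apply_apply]
  rw [h2, isCompactOperator_id_iff_finiteDimensional (𝕜 := ℂ)] at h1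
  exact Fock.not_finiteDimensional h1

/-- The eigenvalues of `W` are among the numbers `u(z₀) aⁿ`, where `z₀` is a fixed point of the
symbol `z ↦ az + b`. -/
theorem exists_eigenvalue_eq (hW : IsWeightedComposition u ψ W) (hu : Differentiable ℂ u)
    {a b z₀ : ℂ} (hψ : ∀ z, ψ z = a * z + b) (hz : ψ z₀ = z₀) {lam : ℂ} {f : Fock p}
    (hf : W f = lam • f) (hf0 : f ≠ 0) : ∃ n : ℕ, lam = u z₀ * a ^ n := by
  have heq (z : ℂ) : u z * f (ψ z) = lam * f z := by
    rw [← hW, hf, Fock.coe_smul]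
    simp
  have han : AnalyticAt ℂ f z₀ := f.differentiable.analyticAt z₀
  have hne : ¬ ∀ᶠ z in nhds z₀, f z = 0 := by
    intro h
    apply hf0
    have hon : AnalyticOnNhd ℂ f Set.univ := fun z _ => f.differentiable.analyticAt z
    exact DFunLike.coe_injective (hon.eq_of_eventuallyEq (g := 0) (fun z _ => analyticAt_const) h)
  -- Here `n` is the order of vanishing of `f` at `z₀`. Since `ψ z - z₀ = a (z - z₀)`, composition
  -- with `ψ` multiplies the leading term by `aⁿ`.
  obtain ⟨n, g, hg, hg0, hfg⟩ := han.exists_eventuallyEq_pow_smul_nonzero_iff.2 hne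
  refine ⟨n, ?_⟩
  have hψc : ContinuousAt ψ z₀ := by
    rw [show ψ = fun z => a * z + b from funext hψ]
    fun_prop
  have hψt : Filter.Tendsto ψ (nhds z₀) (nhds z₀) := by
    have := hψc.tendsto
    rwa [hz] at this
  have hgψ : ContinuousAt (fun z => g (ψ z)) z₀ :=
    ContinuousAt.comp (by rw [hz]; exact hg.continuousAt) hψc
  have hsub (z : ℂ) : ψ z - z₀ = a * (z - z₀) := by
    have h1 := hψ z₀
    rw [hz] at h1
    rw [hψ]
    linear_combination -h1
  -- The power `(z - z₀)ⁿ` cancels only off `z₀`; continuity then carries the identity to `z₀`.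
  have hev : ∀ᶠ z in nhdsWithin z₀ {z₀}ᶜ, u z * (a ^ n * g (ψ z)) = lam * g z := by
    filter_upwards [nhdsWithin_le_nhds hfg, nhdsWithin_le_nhds (hψt.eventually hfg),
      self_mem_nhdsWithin] with z h1 h2 h3
    have h4 := heq z
    rw [h1, h2, hsub, smul_eq_mul, smul_eq_mul, mul_pow] at h4
    have h5 : (z - z₀) ^ n ≠ 0 := pow_ne_zero _ (sub_ne_zero.2 h3)
    apply mul_left_cancel₀ h5
    linear_combination h4
  have hl : Filter.Tendsto (fun z => u z * (a ^ n * g (ψ z))) (nhdsWithin z₀ {z₀}ᶜ)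
      (nhds (u z₀ * (a ^ n * g z₀))) := by
    have h1 : ContinuousAt (fun z => u z * (a ^ n * g (ψ z))) z₀ :=
      hu.continuous.continuousAt.mul (continuousAt_const.mul hgψ)
    have h2 := h1.tendsto
    rw [hz] at h2
    exact h2.mono_left nhdsWithin_le_nhds
  have hr : Filter.Tendsto (fun z => lam * g z) (nhdsWithin z₀ {z₀}ᶜ) (nhds (lam * g z₀)) :=
    (continuousAt_const.mul hg.continuousAt).tendsto.mono_left nhdsWithin_le_nhds
  have hfin := tendsto_nhds_unique (hl.congr' hev) hr
  apply mul_right_cancel₀ hg0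
  rw [← hfin]
  ring

end IsWeightedComposition

/-! ### The theorem. -/

theorem theorem3p1 (p : ℝ) [Fact (1 ≤ p)] (u ψ : ℂ → ℂ)
    (hu : Differentiable ℂ u) (hψ : Differentiable ℂ ψ)
    (W : Fock p →L[ℂ] Fock p) (hW : IsWeightedComposition u ψ W) :
    (u ≠ 0 → ∃ a b : ℂ, ‖a‖ ≤ 1 ∧ ∀ z, ψ z = a * z + b) ∧
    ∀ a b : ℂ, ‖a‖ ≤ 1 → (∀ z, ψ z = a * z + b) →
      (‖a‖ = 1 →
        (RittCondition W ↔
          (a = 1 ∧ b = 0 ∧ ‖u 0‖ < 1) ∨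
          (a = 1 ∧ b = 0 ∧ u 0 = 1) ∨
          (a = 1 ∧ b ≠ 0 ∧ ‖u 0‖ < Real.exp (-‖b‖ ^ 2 / 2)) ∨
          (a ≠ 1 ∧ ‖u 0‖ < Real.exp (-‖b‖ ^ 2 / 2)))) ∧
      (IsCompactOperator W →
        (u ≠ 0 → ‖a‖ < 1) ∧
        (a ≠ 1 →
          (RittCondition W → ‖u (b / (1 - a))‖ ≤ 1) ∧
          (‖u (b / (1 - a))‖ < 1 → RittCondition W))) := by
  refine ⟨hW.exists_affine hu hψ, fun a b ha hab => ?_⟩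
  have hfix (ha1 : a ≠ 1) : ψ (b / (1 - a)) = b / (1 - a) := by
    have h1 : 1 - a ≠ 0 := sub_ne_zero.2 ha1.symm
    rw [hab]
    field_simp
    ring
  refine ⟨fun ha' => ⟨fun hR => ?_, ?_⟩, fun hK => ⟨fun h0 => ?_, fun ha1 => ⟨fun hR => ?_,
    fun hlt => ?_⟩⟩⟩
  · by_cases ha1 : a = 1
    · subst ha1
      by_cases hb : b = 0
      · have hz : ψ 0 = 0 := by rw [hab, hb, mul_zero, add_zero]
        rcases hR.norm_lt_one_or_eq_one (hW.apply_mem_spectrum_of_fixed hz) with h | h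
        · exact Or.inl ⟨rfl, hb, h⟩
        · exact Or.inr (Or.inl ⟨rfl, hb, h⟩)
      · exact Or.inr (Or.inr (Or.inl
          ⟨rfl, hb, hW.norm_lt_of_rittCondition_of_translation hu hb hab hR⟩))
    · exact Or.inr (Or.inr (Or.inr
        ⟨ha1, hW.norm_lt_of_rittCondition_of_ne_one hu ha' ha1 hab (hfix ha1) hR⟩))
  · rintro (⟨rfl, rfl, h⟩ | ⟨rfl, rfl, h⟩ | ⟨_, _, h⟩ | ⟨_, h⟩)
    · exact hW.rittCondition_of_norm_lt hu ha' hab (by simpa using h)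
    · exact hW.rittCondition_of_eq_one hu (fun z => by rw [hab, one_mul, add_zero]) h
    · exact hW.rittCondition_of_norm_lt hu ha' hab h
    · exact hW.rittCondition_of_norm_lt hu ha' hab h
  · exact lt_of_le_of_ne ha (hW.norm_ne_one_of_isCompactOperator hu h0 hab hK)
  · rcases hR.norm_lt_one_or_eq_one (hW.apply_mem_spectrum_of_fixed (hfix ha1)) with h | h
    · exact h.le
    · rw [h, norm_one]
  · refine hK.rittCondition fun lam f hf hf0 => ?_
    obtain ⟨n, rfl⟩ := hW.exists_eigenvalue_eq hu hab (hfix ha1) hf hf0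
    rw [norm_mul, norm_pow]
    exact (mul_le_of_le_one_right (norm_nonneg _) (pow_le_one₀ (norm_nonneg _) ha)).trans_lt hlt
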